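/- Conventions. For a set $A$ of ordinals let $\mathrm{acc}(A)$ be the set of nonzero $\beta\in A$ with $\sup(A\cap\beta)=\beta$, and let $\mathrm{otp}(A)$ be its order type. For a limit ordinal $\delta$, a set $C\subseteq\delta$ is a club in $\delta$ if it is unbounded in $\delta$ and contains every nonzero $\beta<\delta$ with $\sup(C\cap\beta)=\beta$; a set is stationary in $\delta$ if it meets every club in $\delta$. Limit ordinals are nonzero. Write $E^{\delta}_{>\kappa}=\{\alpha<\delta\mid \mathrm{cf}(\alpha)>\kappa\}$ and $E^{\delta}_{\neq\kappa}=\{\alpha<\delta\mid \mathrm{cf}(\alpha)\neq\kappa\}$. A set $S\subseteq\lambda^+$ reflects stationarily often if $\{\alpha\in E^{\lambda^+}_{>\omega}\mid S\cap\alpha\text{ is stationary in }\alpha\}$ is stationary in $\lambda^+$. For an infinite cardinal $\lambda$, $\mathrm{CH}_\lambda$ is the assertion $2^\lambda=\lambda^+$, and $\square_\lambda$ asserts that there is a sequence $\langle C_\alpha\mid\alpha<\lambda^+\rangle$ such that for every limit $\alpha<\lambda^+$, $C_\alpha$ is a club in $\alpha$ with $\mathrm{otp}(C_\alpha)\le\lambda$,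 and $C_\beta=C_\alpha\cap\beta$ for every $\beta\in\mathrm{acc}(C_\alpha)$. For an uncountable cardinal $\lambda$ and $S\subseteq\lambda^+$, let $\boxtimes'_\lambda(S)$ (square with built-in diamond, guessing in $S$) assert that there is a sequence $\langle (C_\alpha,S_\alpha)\mid\alpha<\lambda^+\rangle$ of pairs of sets of ordinals such that: (1) for every limit $\alpha<\lambda^+$, $C_\alpha$ is a club in $\alpha$ with $\mathrm{otp}(C_\alpha)\le\lambda$; (2) for all $\alpha<\lambda^+$ and $\beta\in\mathrm{acc}(C_\alpha)$, $C_\beta=C_\alpha\cap\beta$ and $S_\beta=S_\alpha\cap\beta$; (3) for every club $D$ in $\lambda^+$ and every $A\subseteq\lambda^+$ there is a limit $\alpha<\lambda^+$ such that $C_\alpha\subseteq D$, $S_\alpha=A\cap\alpha$, $\alpha\in S$ and $\sup(\mathrm{acc}(C_\alpha))=\alpha$. Theorem. Let $\lambda$ be an uncountable cardinal such that $\square_\lambda$ and $\mathrm{CH}_\lambda$ hold. Then: (1) $\boxtimes'_\lambda(T)$ holds for every $T\subseteq E^{\lambda^+}_{>\omega}\cap E^{\lambda^+}_{\neq\mathrm{cf}(\lambda)}$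 that is stationary in $\lambda^+$; (2) $\boxtimes'_\lambda(S)$ holds for every $S\subseteq\lambda^+$ that reflects stationarily often. -/

import Mathlib

open Set

universe u

namespace OstSquare

/-- The cardinal successor `λ⁺`, as an initial ordinal. -/
noncomputable def succOrd (lam : Cardinal.{u}) : Ordinal.{u} := (Order.succ lam).ord

/-- The order type of a set of ordinals is at most the ordinal `o`.
The order type of a set of ordinals of `Ordinal.{u}` lives one universe up. -/
def OtpLE (C : Set Ordinal.{u}) (o : Ordinal.{u}) : Prop :=
  Ordinal.type (fun x y : C => x < y) ≤ Ordinal.lift.{u + 1} o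

/-- `acc(A)`: the (nonzero) accumulation points of `A` that belong to `A`. -/
def acc (A : Set Ordinal.{u}) : Set Ordinal.{u} :=
  {β | β ∈ A ∧ β ≠ 0 ∧ IsLUB (A ∩ Iio β) β}

/-- `C` is a club subset of `δ = {α | α < δ}`. -/
def IsClubIn (C : Set Ordinal.{u}) (δ : Ordinal.{u}) : Prop :=
  C ⊆ Iio δ ∧ IsClub ((fun x : Iio δ => (x : Ordinal.{u})) ⁻¹' C)

/-- `S ∩ δ` is stationary in `δ`. -/
def IsStationaryIn (S : Set Ordinal.{u}) (δ : Ordinal.{u}) : Prop :=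
  IsStationary ((fun x : Iio δ => (x : Ordinal.{u})) ⁻¹' S)

/-- `E^δ_{>κ}`. -/
def EGt (δ : Ordinal.{u}) (κ : Cardinal.{u}) : Set Ordinal.{u} :=
  {α | α < δ ∧ κ < α.cof}

/-- `E^δ_{≠κ}`. -/
def ENe (δ : Ordinal.{u}) (κ : Cardinal.{u}) : Set Ordinal.{u} :=
  {α | α < δ ∧ α.cof ≠ κ}

/-- `S ⊆ δ` reflects stationarily often: stationarily many `α < δ` of uncountable cofinality are
such that `S ∩ α` is stationary in `α`. -/
def ReflectsStationarilyOften (S : Set Ordinal.{u}) (δ : Ordinal.{u}) : Prop :=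
  IsStationaryIn {α | α ∈ EGt δ Cardinal.aleph0 ∧ IsStationaryIn S α} δ

/-- Jensen's square principle at `λ`. -/
def Square (lam : Cardinal.{u}) : Prop :=
  ∃ C : Ordinal.{u} → Set Ordinal.{u},
    ∀ α < succOrd lam, Order.IsSuccLimit α →
      IsClubIn (C α) α ∧ OtpLE (C α) lam.ord ∧
      ∀ β ∈ acc (C α), C β = C α ∩ Iio β

/-- The local continuum hypothesis at `λ`. -/
def CH (lam : Cardinal.{u}) : Prop := (2 : Cardinal.{u}) ^ lam = Order.succ lam

/-- Square with built-in diamond, where the guesses take place at points of `S`. Only the values of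
`C` and `Z` below `λ⁺` matter. `Order.IsSuccLimit` means: nonzero limit ordinal. -/
def SquareDiamond' (lam : Cardinal.{u}) (S : Set Ordinal.{u}) : Prop :=
  ∃ C Z : Ordinal.{u} → Set Ordinal.{u},
    (∀ α < succOrd lam, Order.IsSuccLimit α → IsClubIn (C α) α ∧ OtpLE (C α) lam.ord) ∧
    (∀ α < succOrd lam, ∀ β ∈ acc (C α), C β = C α ∩ Iio β ∧ Z β = Z α ∩ Iio β) ∧
    ∀ D A : Set Ordinal.{u}, IsClubIn D (succOrd lam) → A ⊆ Iio (succOrd lam) →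
      ∃ α < succOrd lam, Order.IsSuccLimit α ∧
        C α ⊆ D ∧ Z α = A ∩ Iio α ∧ α ∈ S ∧ IsLUB (acc (C α)) α

end OstSquare

/-! Suppose guessing in `T` fails. By `CH`, λ⁺ codes list all restrictions to ordinals β < λ⁺ of λ ×
λ matrices of pairs of sets (`exists_codes`). For j, k < λ, a candidate sequence is read off the
square sequence: along C_δ, greedily pick pairs (β, ν) for which one of the first j ordinals
enumerated for ν codes a matrix agreeing up to β, in row j, with the terms Y j k' already built, k'
< k. The k-th entry of such a code is the prediction; the predicted sets are glued into a guess.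
Greedy choices are decided from below, so candidates are coherent (`thin_inter_Iio`,
`guess_inter_Iio`). Let Y j k be a club and a set that candidate (j, k) fails to guess.

Take α ∈ R, a limit of points lying in all these clubs and closed under coding, and let B be the set
of such points in C_α. If ν is the next point of B after β ∈ B, the code of Y up to β lies below ν
and is enumerated at some stage i(β) < λ. `CatchesIn` provides δ ∈ T such that C_δ is an initial
segment of C_α with fewer than λ points, and a single j bounding i on a set of which δ is a limit of
limits. For this j, the codes still correct before step k shrink with k; fewer than λ triples are
involved, so some step k < λ loses none (`exists_stable_stage`). The survivors are right about Y j k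
as well, so candidate (j, k) succeeds at δ, a contradiction (`squareDiamond'_of_catchesIn`).

The two claims differ only in how δ is caught: δ = α in `catchesIn_self`, a reflected point δ < α in
`catchesIn_of_reflects`. -/

namespace OstSquare

/-! ### Clubs, limit points and cofinality -/

section

/-- `N` has elements below `δ` above every ordinal less than `δ`. -/
def CofinalIn (N : Set Ordinal.{u}) (δ : Ordinal.{u}) : Prop :=
  ∀ ξ < δ, ∃ ν ∈ N, ξ < ν ∧ ν < δ

/-- The nonzero ordinals that are suprema of smaller elements of `N`. -/
def limitPoints (N : Set Ordinal.{u}) : Set Ordinal.{u} :=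
  {β | β ≠ 0 ∧ CofinalIn N β}

variable {N M : Set Ordinal.{u}} {δ β : Ordinal.{u}}

theorem CofinalIn.mono (h : CofinalIn N δ) (hNM : ∀ ν ∈ N, ν < δ → ν ∈ M) : CofinalIn M δ := by
  intro ξ hξ
  obtain ⟨ν, h1, h2, h3⟩ := h ξ hξ
  exact ⟨ν, hNM ν h1 h3, h2, h3⟩

theorem not_cofinalIn : ¬ CofinalIn N δ ↔ ∃ ξ < δ, ∀ ν ∈ N, ν < δ → ν ≤ ξ := by
  unfold CofinalIn
  push Not
  constructor
  · rintro ⟨ξ, hξ, h⟩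
    refine ⟨ξ, hξ, fun ν hν hν' => ?_⟩
    by_contra! hc
    exact absurd (h ν hν hc) (not_le.2 hν')
  · rintro ⟨ξ, hξ, h⟩
    refine ⟨ξ, hξ, fun ν hν hν' => ?_⟩
    by_contra! hc
    exact absurd (h ν hν hc) (not_le.2 hν')

theorem CofinalIn.isSuccLimit (h : CofinalIn N δ) (h0 : δ ≠ 0) : Order.IsSuccLimit δ := by
  refine ⟨by simpa using h0, fun ξ hξ => ?_⟩
  obtain ⟨ν, -, h2, h3⟩ := h ξ hξ.lt
  exact hξ.2 h2 h3

theorem cofinalIn_limitPoints (h : CofinalIn (limitPoints N) δ) : CofinalIn N δ := by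
  intro ξ hξ
  obtain ⟨ν, hν, h2, h3⟩ := h ξ hξ
  obtain ⟨μ, hμ, h4, h5⟩ := hν.2 ξ h2
  exact ⟨μ, hμ, h4, h5.trans h3⟩

theorem isLUB_iff_cofinalIn :
    IsLUB (N ∩ Iio δ) δ ↔ CofinalIn N δ := by
  constructor
  · intro h ξ hξ
    obtain ⟨ν, ⟨hν, hνδ⟩, h1, -⟩ := h.exists_between hξ
    exact ⟨ν, hν, h1, hνδ⟩
  · intro h
    refine ⟨fun x hx => hx.2.le, fun x hx => ?_⟩
    by_contra! hc
    obtain ⟨ν, hν, h1, h2⟩ := h x hc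
    exact absurd (hx ⟨hν, h2⟩) (not_le.2 h1)

theorem mem_acc : β ∈ acc N ↔ β ∈ N ∧ β ∈ limitPoints N := by
  unfold acc limitPoints
  constructor
  · rintro ⟨h1, h2, h3⟩
    exact ⟨h1, h2, isLUB_iff_cofinalIn.1 h3⟩
  · rintro ⟨h1, h2, h3⟩
    exact ⟨h1, h2, isLUB_iff_cofinalIn.2 h3⟩

theorem isClubIn_iff (hδ : Order.IsSuccLimit δ) :
    IsClubIn N δ ↔ N ⊆ Iio δ ∧ CofinalIn N δ ∧ ∀ β < δ, β ∈ limitPoints N → β ∈ N := by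
  refine ⟨fun ⟨h, hc⟩ => ⟨h, fun ξ hξ => ?_, fun β hβ hN => ?_⟩, fun ⟨h, hu, hc⟩ => ⟨h, ?_, ?_⟩⟩
  · obtain ⟨b, hb, hb'⟩ := hc.isCofinal ⟨Order.succ ξ, hδ.succ_lt hξ⟩
    exact ⟨b, hb, (Order.lt_succ ξ).trans_le hb', b.2⟩
  · refine hc.isLUB_mem (x := ⟨β, hβ⟩) (t := {x : Iio δ | (x : Ordinal) ∈ N ∧ x < ⟨β, hβ⟩})
      (fun x hx => hx.1) ?_ ⟨fun x hx => hx.2.le, fun x hx => ?_⟩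
    · obtain ⟨ν, hν, -, h2⟩ := hN.2 0 (pos_iff_ne_zero.2 hN.1)
      exact ⟨⟨ν, h2.trans hβ⟩, hν, h2⟩
    · by_contra! hlt
      obtain ⟨ν, hν, h1, h2⟩ := hN.2 x hlt
      exact absurd (hx (a := ⟨ν, h2.trans hβ⟩) ⟨hν, h2⟩) (not_le.2 h1)
  · rw [dirSupClosed_iff_of_linearOrder]
    intro d hd hne a ha
    by_cases had : a ∈ d
    · exact hd had
    refine hc a a.2 ⟨?_, ?_⟩
    · rintro h0
      obtain ⟨x, hx⟩ := hne
      have : x = a := le_antisymm (ha.1 hx) (by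
        show (a : Ordinal) ≤ x
        rw [h0]; exact zero_le)
      exact had (this ▸ hx)
    · intro ξ hξ
      obtain ⟨ν, hν, h1, h2⟩ := ha.exists_between (b := ⟨ξ, hξ.trans a.2⟩) hξ
      exact ⟨ν, hd hν, h1, lt_of_le_of_ne h2 (fun he => had (by rwa [← Subtype.ext he]))⟩
  · intro x
    obtain ⟨ν, hν, h1, h2⟩ := hu x x.2
    exact ⟨⟨ν, h2⟩, hν, h1.le⟩

theorem cof_Iio_ordinal (δ : Ordinal.{u}) :
    Order.cof (Iio δ) = Cardinal.lift.{u + 1} δ.cof := by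
  rw [Ordinal.cof_Iio, Ordinal.lift_cof]

theorem cof_Iio_ne_aleph0 (hδ : Cardinal.aleph0 < δ.cof) :
    Order.cof (Iio δ) ≠ Cardinal.aleph0 := by
  rw [cof_Iio_ordinal]
  intro h
  rw [Cardinal.lift_eq_aleph0] at h
  exact hδ.ne' h

theorem isSuccLimit_of_aleph0_lt_cof (hδ : Cardinal.aleph0 < δ.cof) : Order.IsSuccLimit δ :=
  Ordinal.one_lt_cof_iff.1 (Cardinal.one_lt_aleph0.trans hδ)

theorem IsClubIn.inter (hδ : Cardinal.aleph0 < δ.cof) (h1 : IsClubIn N δ) (h2 : IsClubIn M δ) :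
    IsClubIn (N ∩ M) δ :=
  ⟨fun _ hx => h1.1 hx.1, h1.2.inter (cof_Iio_ne_aleph0 hδ) h2.2⟩

theorem IsClubIn.iInter {ι : Type (u + 1)} [Nonempty ι] (hδ : Cardinal.aleph0 < δ.cof)
    (hι : Cardinal.mk ι < Cardinal.lift.{u + 1} δ.cof) {D : ι → Set Ordinal.{u}}
    (h : ∀ i, IsClubIn (D i) δ) : IsClubIn (⋂ i, D i) δ := by
  refine ⟨fun x hx => (h (Classical.arbitrary ι)).1 (mem_iInter.1 hx _), ?_⟩
  rw [preimage_iInter]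
  refine IsClub.iInter (cof_Iio_ne_aleph0 hδ) ?_ fun i => (h i).2
  rw [cof_Iio_ordinal]
  simpa using hι

theorem IsStationaryIn.exists_mem (h : IsStationaryIn N δ) (hM : IsClubIn M δ) :
    ∃ x ∈ N, x ∈ M ∧ x < δ := by
  obtain ⟨x, hx, hx'⟩ := h hM.2
  exact ⟨x, hx, hx', x.2⟩

/-- Sets of size less than the cofinality are strictly bounded. -/
theorem exists_bound_of_mk_lt (hN : N ⊆ Iio δ)
    (hc : Cardinal.mk N < Cardinal.lift.{u + 1} δ.cof) : ∃ ξ < δ, ∀ ν ∈ N, ν < ξ := by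
  refine ⟨sSup ((· + 1) '' N), ?_, fun ν hν => ?_⟩
  · refine Ordinal.sSup_add_one_lt_of_lt_cof ?_ fun i hi => hN hi
    rwa [← Ordinal.lift_cof]
  · have hb : BddAbove ((· + 1) '' N) := by
      refine ⟨δ, ?_⟩
      rintro _ ⟨x, hx, rfl⟩
      exact Order.add_one_le_of_lt (hN hx)
    exact (Order.lt_add_one_iff.2 le_rfl).trans_le (le_csSup hb ⟨ν, hν, rfl⟩)

theorem CofinalIn.lift_cof_le (hN : N ⊆ Iio δ) (h : CofinalIn N δ) :
    Cardinal.lift.{u + 1} δ.cof ≤ Cardinal.mk N := by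
  by_contra! hc
  obtain ⟨ξ, hξ, hb⟩ := exists_bound_of_mk_lt hN hc
  obtain ⟨ν, hν, h1, -⟩ := h ξ hξ
  exact (hb ν hν).not_gt h1

/-- A cofinal set has a cofinal subset of order type the cofinality. -/
theorem CofinalIn.exists_subset (h : CofinalIn N δ) (hδ : Order.IsSuccLimit δ) :
    ∃ Q ⊆ N, Q ⊆ Iio δ ∧ CofinalIn Q δ ∧
      Ordinal.type (fun x y : Q => x < y) = Ordinal.lift.{u + 1} δ.cof.ord := by
  have hc : IsCofinal {x : Iio δ | (x : Ordinal) ∈ N} := by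
    intro x
    obtain ⟨ν, hν, h1, h2⟩ := h x x.2
    exact ⟨⟨ν, h2⟩, hν, h1.le⟩
  obtain ⟨t, ht, htc, hty⟩ := Ordinal.exists_ord_cof_eq_of_isCofinal hc
  refine ⟨Subtype.val '' t, ?_, ?_, fun ξ hξ => ?_, ?_⟩
  · rintro _ ⟨x, hx, rfl⟩; exact ht hx
  · rintro _ ⟨x, hx, rfl⟩; exact x.2
  · obtain ⟨y, hy, hy'⟩ := htc ⟨Order.succ ξ, hδ.succ_lt hξ⟩
    exact ⟨y, ⟨y, hy, rfl⟩, (Order.lt_succ ξ).trans_le hy', y.2⟩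
  · rw [cof_Iio_ordinal, ← Cardinal.lift_ord] at hty
    rw [← hty]
    exact (((Subtype.strictMono_coe _).strictMonoOn t).orderIso.ordinalType_congr).symm

/-- Iterate `h` ω times from `ξ`; uncountable cofinality keeps the supremum below `δ`. This is the
source of unboundedness in the club arguments. -/
theorem exists_gt_of_step (hδ : Cardinal.aleph0 < δ.cof) (h : Ordinal.{u} → Ordinal.{u})
    (hh : ∀ ξ < δ, ξ < h ξ ∧ h ξ < δ) {ξ : Ordinal.{u}} (hξ : ξ < δ) :
    ∃ η, ξ < η ∧ η < δ ∧ ∀ ζ < η, ∃ ζ', ζ < ζ' ∧ ζ' < η ∧ h ζ' < η := by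
  let s : ℕ → Ordinal.{u} := fun n => h^[n] ξ
  have hs : ∀ n, s n < δ := by
    intro n
    induction n with
    | zero => exact hξ
    | succ n ih => simp only [s, Function.iterate_succ_apply']; exact (hh _ ih).2
  have hs1 : ∀ n, s (n + 1) = h (s n) := fun n => Function.iterate_succ_apply' h n ξ
  have hs2 : ∀ n, s n < s (n + 1) := fun n => by rw [hs1]; exact (hh _ (hs n)).1
  have hmem : ∀ n, s n < ⨆ n, s n := fun n => (hs2 n).trans_le (Ordinal.le_iSup s (n + 1))
  refine ⟨⨆ n, s n, hmem 0, ?_, fun ζ hζ => ?_⟩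
  · apply Ordinal.lift_iSup_lt_of_lt_cof _ hs
    rw [← Ordinal.lift_cof]
    simpa using hδ
  · obtain ⟨n, hn⟩ := (Ordinal.lt_iSup_iff).1 hζ
    exact ⟨s n, hn, hmem n, by rw [← hs1]; exact hmem _⟩

theorem isClubIn_limitPoints (hδ : Cardinal.aleph0 < δ.cof) (hN : CofinalIn N δ) :
    IsClubIn (limitPoints N ∩ Iio δ) δ := by
  rw [isClubIn_iff (isSuccLimit_of_aleph0_lt_cof hδ)]
  refine ⟨inter_subset_right, fun ξ hξ => ?_, fun β hβ h => ⟨⟨h.1, ?_⟩, hβ⟩⟩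
  · choose! h hh using hN
    obtain ⟨η, h1, h2, h3⟩ := exists_gt_of_step hδ h (fun ξ hξ => (hh ξ hξ).2) hξ
    refine ⟨η, ⟨⟨(pos_of_gt h1).ne', fun ζ hζ => ?_⟩, h2⟩, h1, h2⟩
    obtain ⟨ζ', h4, h5, h6⟩ := h3 ζ hζ
    exact ⟨h ζ', (hh _ (h5.trans h2)).1, h4.trans (hh _ (h5.trans h2)).2.1, h6⟩
  · exact cofinalIn_limitPoints (h.2.mono fun ν hν _ => hν.1)

theorem IsClubIn.cofinalIn (hδ : Order.IsSuccLimit δ) (h : IsClubIn N δ) : CofinalIn N δ :=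
  ((isClubIn_iff hδ).1 h).2.1

theorem isClubIn_Iio (hδ : Order.IsSuccLimit δ) : IsClubIn (Iio δ) δ := by
  rw [isClubIn_iff hδ]
  exact ⟨subset_rfl, fun ξ hξ => ⟨_, hδ.succ_lt hξ, Order.lt_succ ξ, hδ.succ_lt hξ⟩,
    fun β hβ _ => hβ⟩

/-- A function into `λ` on a cofinal subset of `δ` is bounded on a cofinal subset, if the
cofinalities of `δ` and `λ` differ. -/
theorem CofinalIn.exists_bounded {l : Ordinal.{u}} (hl : Order.IsSuccLimit l)
    (hδ : Order.IsSuccLimit δ) (hne : δ.cof ≠ l.cof) (hN : CofinalIn N δ)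
    {i : Ordinal.{u} → Ordinal.{u}} (hi : ∀ ν ∈ N, ν < δ → i ν < l) :
    ∃ j < l, CofinalIn {ν ∈ N | i ν < j} δ := by
  by_contra! hcon
  have hb : ∀ j < l, ∃ ξ < δ, ∀ ν ∈ N, i ν < j → ν < δ → ν ≤ ξ := by
    intro j hj
    obtain ⟨ξ, hξ, h⟩ := not_cofinalIn.1 (hcon j hj)
    exact ⟨ξ, hξ, fun ν h1 h2 h3 => h ν ⟨h1, h2⟩ h3⟩
  choose! g hg hgN using hb
  have hmk : ∀ {Q : Set Ordinal.{u}} {c : Cardinal.{u}},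
      Ordinal.type (fun x y : Q => x < y) = Ordinal.lift.{u + 1} c.ord →
      Cardinal.mk Q = Cardinal.lift.{u + 1} c := by
    intro Q c h
    simpa using congrArg Ordinal.card h
  refine hne (le_antisymm ?_ ?_)
  -- With `g j` bounding the points of value below `j`, the image under `g` of a cofinal subset of
  -- `l` is unbounded in `δ`.
  · obtain ⟨K, -, hKl, hKc, hKt⟩ := (isClubIn_Iio hl).cofinalIn hl |>.exists_subset hl
    rw [← Cardinal.lift_le.{u + 1}, ← hmk hKt]
    refine le_trans ?_ (Cardinal.mk_image_le (f := g) (s := K))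
    by_contra! hc
    obtain ⟨ξ, hξ, hb⟩ := exists_bound_of_mk_lt (δ := δ) (N := g '' K) (by
      rintro _ ⟨k, hk, rfl⟩; exact hg k (hKl hk)) hc
    obtain ⟨ν, hν, h1, h2⟩ := hN ξ hξ
    obtain ⟨k, hk, h3, h4⟩ := hKc (i ν) (hi ν hν h2)
    exact absurd (h1.le.trans (hgN k h4 ν hν h3 h2)) (not_le.2 (hb _ ⟨k, hk, rfl⟩))
  -- Conversely `i` is unbounded in `l` on any cofinal subset of `N`: a bound `j` would confine that
  -- subset below `g j`.
  · obtain ⟨Q, hQN, hQδ, hQc, hQt⟩ := hN.exists_subset hδ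
    rw [← Cardinal.lift_le.{u + 1}, ← hmk hQt]
    refine le_trans ?_ (Cardinal.mk_image_le (f := i) (s := Q))
    by_contra! hc
    obtain ⟨j, hj, hb⟩ := exists_bound_of_mk_lt (δ := l) (N := i '' Q) (by
      rintro _ ⟨k, hk, rfl⟩; exact hi k (hQN hk) (hQδ hk)) hc
    obtain ⟨ν, hν, h1, h2⟩ := hQc (g j) (hg j hj)
    exact absurd (hgN j hj ν (hQN hν) (hb _ ⟨ν, hν, rfl⟩) h2) (not_le.2 h1)

end

/-! ### Greedy selection: thinned clubs and glued guesses -/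

section

/-- Greedy selection of points `ν` of `C`: a point is picked if there is some `β ∈ C ∩ ν`, not below
any previously picked point, for which the pair `(β, ν)` is good. -/
def Picked (good : Ordinal.{u} → Ordinal.{u} → Prop) (C : Set Ordinal.{u}) (ν : Ordinal.{u}) :
    Prop :=
  ν ∈ C ∧ ∃ β ∈ C, β < ν ∧ good β ν ∧ ∀ ν' < ν, Picked good C ν' → ν' ≤ β
termination_by ν

/-- The witnesses for `ν` to be picked. -/
def pickWitnesses (good : Ordinal.{u} → Ordinal.{u} → Prop) (C : Set Ordinal.{u})
    (ν : Ordinal.{u}) : Set Ordinal.{u} :=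
  {β | β ∈ C ∧ β < ν ∧ good β ν ∧ ∀ ν' < ν, Picked good C ν' → ν' ≤ β}

/-- The least witness for `ν` to be picked. -/
noncomputable def pickBase (good : Ordinal.{u} → Ordinal.{u} → Prop) (C : Set Ordinal.{u})
    (ν : Ordinal.{u}) : Ordinal.{u} :=
  sInf (pickWitnesses good C ν)

/-- The bases of the picked points. -/
def pickBases (good : Ordinal.{u} → Ordinal.{u} → Prop) (C : Set Ordinal.{u}) :
    Set Ordinal.{u} :=
  {x | ∃ ν, Picked good C ν ∧ pickBase good C ν = x}

/-- The closure in `C` of the set of bases, together with the points of `C` above all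
picked points. -/
def thin (good : Ordinal.{u} → Ordinal.{u} → Prop) (C : Set Ordinal.{u}) : Set Ordinal.{u} :=
  {x ∈ C | x ∈ pickBases good C ∨ x ∈ limitPoints (pickBases good C) ∨
    ∀ ν, Picked good C ν → ν < x}

/-- The set of all `ξ < δ` that belong to the set attached to the first pair of the greedy
selection reaching `ξ`. -/
def guess (good : Ordinal.{u} → Ordinal.{u} → Prop) (G : Ordinal.{u} → Ordinal.{u} → Set Ordinal.{u})
    (C : Set Ordinal.{u}) (δ : Ordinal.{u}) : Set Ordinal.{u} :=
  {ξ | ξ < δ ∧ ∃ ν, Picked good C ν ∧ ξ ≤ pickBase good C ν ∧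
    (∀ ν' < ν, Picked good C ν' → pickBase good C ν' < ξ) ∧ ξ ∈ G (pickBase good C ν) ν}

variable {good : Ordinal.{u} → Ordinal.{u} → Prop}
  {G : Ordinal.{u} → Ordinal.{u} → Set Ordinal.{u}} {C : Set Ordinal.{u}}
  {δ γ ν ν' : Ordinal.{u}}

theorem picked_iff : Picked good C ν ↔ ν ∈ C ∧ (pickWitnesses good C ν).Nonempty := by
  rw [Picked]; rfl

theorem Picked.mem (h : Picked good C ν) : ν ∈ C := (picked_iff.1 h).1

theorem Picked.pickBase_mem (h : Picked good C ν) :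
    pickBase good C ν ∈ pickWitnesses good C ν := csInf_mem (picked_iff.1 h).2

theorem Picked.pickBase_lt (h : Picked good C ν) : pickBase good C ν < ν := h.pickBase_mem.2.1

theorem Picked.le_pickBase (h : Picked good C ν) (h' : Picked good C ν') (hlt : ν' < ν) :
    ν' ≤ pickBase good C ν := h.pickBase_mem.2.2.2 ν' hlt h'

theorem Picked.lt_of_pickBase_lt (h : Picked good C ν) (h' : Picked good C ν')
    (hlt : pickBase good C ν' < pickBase good C ν) : ν' < ν := by
  by_contra! hc
  rcases hc.eq_or_lt with rfl | hc
  · exact hlt.false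
  · exact absurd (h.pickBase_lt.trans_le (h'.le_pickBase h hc)) hlt.not_gt

/-- Whether `ν` is picked depends only on the points of `C` up to `ν`; coherence of the whole
construction rests on this. -/
theorem picked_inter_Iio : Picked good (C ∩ Iio γ) ν ↔ Picked good C ν ∧ ν < γ := by
  induction ν using WellFoundedLT.induction with
  | ind ν ih =>
    rw [picked_iff, picked_iff]
    constructor
    · rintro ⟨⟨hC, hγ⟩, β, ⟨h1, -⟩, h2, h3, h4⟩
      exact ⟨⟨hC, β, h1, h2, h3, fun ν' hν' hp => h4 ν' hν' ((ih ν' hν').2 ⟨hp, hν'.trans hγ⟩)⟩, hγ⟩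
    · rintro ⟨⟨hC, β, h1, h2, h3, h4⟩, hγ⟩
      exact ⟨⟨hC, hγ⟩, β, ⟨h1, h2.trans hγ⟩, h2, h3,
        fun ν' hν' hp => h4 ν' hν' ((ih ν' hν').1 hp).1⟩

theorem pickBase_inter_Iio (h : ν < γ) :
    pickBase good (C ∩ Iio γ) ν = pickBase good C ν := by
  unfold pickBase
  congr 1
  ext β
  constructor
  · rintro ⟨⟨h1, -⟩, h2, h3, h4⟩
    exact ⟨h1, h2, h3, fun ν' hν' hp => h4 ν' hν' (picked_inter_Iio.2 ⟨hp, hν'.trans h⟩)⟩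
  · rintro ⟨h1, h2, h3, h4⟩
    exact ⟨⟨h1, h2.trans h⟩, h2, h3, fun ν' hν' hp => h4 ν' hν' (picked_inter_Iio.1 hp).1⟩

theorem mem_pickBases_inter_Iio {x : Ordinal.{u}} :
    x ∈ pickBases good (C ∩ Iio γ) ↔ ∃ ν, Picked good C ν ∧ ν < γ ∧ pickBase good C ν = x := by
  constructor
  · rintro ⟨ν, h, rfl⟩
    obtain ⟨h1, h2⟩ := picked_inter_Iio.1 h
    exact ⟨ν, h1, h2, (pickBase_inter_Iio h2).symm⟩
  · rintro ⟨ν, h1, h2, rfl⟩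
    exact ⟨ν, picked_inter_Iio.2 ⟨h1, h2⟩, pickBase_inter_Iio h2⟩

theorem cofinalIn_picked (h : CofinalIn (pickBases good C) γ) :
    CofinalIn {ν | Picked good C ν} γ := by
  intro ξ hξ
  obtain ⟨_, ⟨ν, hν, rfl⟩, h1, h2⟩ := h ξ hξ
  obtain ⟨_, ⟨ν', hν', rfl⟩, h3, h4⟩ := h _ h2
  exact ⟨ν, hν, h1.trans hν.pickBase_lt, (hν'.le_pickBase hν (hν'.lt_of_pickBase_lt hν h3)).trans_lt h4⟩

theorem cofinalIn_pickBases (h : CofinalIn {ν | Picked good C ν} γ) :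
    CofinalIn (pickBases good C) γ := by
  intro ξ hξ
  obtain ⟨ν, hν, h1, h2⟩ := h ξ hξ
  obtain ⟨ν', hν', h3, h4⟩ := h ν h2
  exact ⟨_, ⟨ν', hν', rfl⟩, h1.trans_le (hν'.le_pickBase hν h3), hν'.pickBase_lt.trans h4⟩

theorem thin_subset : thin good C ⊆ C := fun _ hx => hx.1

theorem pickBases_subset : pickBases good C ⊆ C := by
  rintro _ ⟨ν, h, rfl⟩
  exact h.pickBase_mem.1

/-- A limit point of the thinned set is a limit of picked points or is above all of them. -/
theorem limitPoints_thin_cases (hγ : γ ∈ limitPoints (thin good C)) :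
    CofinalIn {ν | Picked good C ν} γ ∨
      ∃ x < γ, x ∈ C ∧ ∀ ν, Picked good C ν → ν < x := by
  by_cases h : ∃ x < γ, x ∈ C ∧ ∀ ν, Picked good C ν → ν < x
  · exact Or.inr h
  refine Or.inl (cofinalIn_picked fun ξ hξ => ?_)
  push Not at h
  obtain ⟨x, ⟨hxC, hx⟩, h1, h2⟩ := hγ.2 ξ hξ
  rcases hx with hx | hx | hx
  · exact ⟨x, hx, h1, h2⟩
  · obtain ⟨y, hy, h3, h4⟩ := hx.2 ξ h1
    exact ⟨y, hy, h3, h4.trans h2⟩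
  · obtain ⟨ν, hν, h3⟩ := h x h2 hxC
    exact absurd (hx ν hν) (not_lt.2 h3)

/-- No picked pair straddles a limit point of the thinned set, so cutting there loses no base below
it. -/
theorem lt_of_pickBase_lt_of_limitPoints (hγ : γ ∈ limitPoints (thin good C))
    (hν : Picked good C ν) (hlt : pickBase good C ν < γ) : ν < γ := by
  rcases limitPoints_thin_cases hγ with h | ⟨x, hx, -, h⟩
  · obtain ⟨ν', hν', h1, h2⟩ := h _ hlt
    by_contra! hc
    exact absurd (hν.le_pickBase hν' (h2.trans_le hc)) (not_le.2 h1)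
  · exact (h ν hν).trans hx

theorem thin_inter_Iio (hγ : γ ∈ limitPoints (thin good C)) :
    thin good (C ∩ Iio γ) = thin good C ∩ Iio γ := by
  have hb : ∀ x < γ, x ∈ pickBases good (C ∩ Iio γ) ↔ x ∈ pickBases good C := by
    intro x hx
    rw [mem_pickBases_inter_Iio]
    constructor
    · rintro ⟨ν, h1, h2, rfl⟩; exact ⟨ν, h1, rfl⟩
    · rintro ⟨ν, h1, rfl⟩; exact ⟨ν, h1, lt_of_pickBase_lt_of_limitPoints hγ h1 hx, rfl⟩
  have hl : ∀ x < γ, x ∈ limitPoints (pickBases good (C ∩ Iio γ)) ↔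
      x ∈ limitPoints (pickBases good C) := by
    intro x hx
    refine and_congr_right fun _ => ⟨fun h => ?_, fun h => ?_⟩
    · exact h.mono fun ν h1 h2 => (hb ν (h2.trans hx)).1 h1
    · exact h.mono fun ν h1 h2 => (hb ν (h2.trans hx)).2 h1
  have ha : ∀ x < γ, (∀ ν, Picked good (C ∩ Iio γ) ν → ν < x) ↔ ∀ ν, Picked good C ν → ν < x := by
    intro x hx
    refine ⟨fun h ν hν => ?_, fun h ν hν => h ν (picked_inter_Iio.1 hν).1⟩
    rcases limitPoints_thin_cases hγ with hc | ⟨y, hy, -, hc⟩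
    · obtain ⟨ν', hν', h1, h2⟩ := hc x hx
      exact absurd (h ν' (picked_inter_Iio.2 ⟨hν', h2⟩)) h1.not_gt
    · exact h ν (picked_inter_Iio.2 ⟨hν, (hc ν hν).trans hy⟩)
  ext x
  constructor
  · rintro ⟨⟨h1, h2⟩, h3⟩
    refine ⟨⟨h1, ?_⟩, h2⟩
    rwa [hb x h2, hl x h2, ha x h2] at h3
  · rintro ⟨⟨h1, h3⟩, h2⟩
    refine ⟨⟨h1, h2⟩, ?_⟩
    rwa [hb x h2, hl x h2, ha x h2]

theorem guess_inter_Iio (hγ : γ ∈ limitPoints (thin good C)) (hγδ : γ ≤ δ) :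
    guess good G (C ∩ Iio γ) γ = guess good G C δ ∩ Iio γ := by
  ext ξ
  constructor
  · rintro ⟨h1, ν, h2, h3, h4, h5⟩
    obtain ⟨hp, hlt⟩ := picked_inter_Iio.1 h2
    rw [pickBase_inter_Iio hlt] at h3 h5
    refine ⟨⟨h1.trans_le hγδ, ν, hp, h3, fun ν' h6 h7 => ?_, h5⟩, h1⟩
    rw [← pickBase_inter_Iio (h6.trans hlt)]
    exact h4 ν' h6 (picked_inter_Iio.2 ⟨h7, h6.trans hlt⟩)
  · rintro ⟨⟨-, ν, hp, h3, h4, h5⟩, h1⟩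
    have hlt : ν < γ := by
      rcases limitPoints_thin_cases hγ with hc | ⟨y, hy, -, hc⟩
      · obtain ⟨_, ⟨ν', hν', rfl⟩, h6, h7⟩ := cofinalIn_pickBases hc ξ h1
        by_contra! hcon
        have h8 := lt_of_pickBase_lt_of_limitPoints hγ hν' h7
        exact absurd (h4 ν' (h8.trans_le hcon) hν') h6.not_gt
      · exact (hc ν hp).trans hy
    refine ⟨h1, ν, picked_inter_Iio.2 ⟨hp, hlt⟩, ?_, fun ν' h6 h7 => ?_, ?_⟩
    · rwa [pickBase_inter_Iio hlt]
    · rw [pickBase_inter_Iio (h6.trans hlt)]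
      exact h4 ν' h6 (picked_inter_Iio.1 h7).1
    · rwa [pickBase_inter_Iio hlt]

theorem isClubIn_thin (hδ : Order.IsSuccLimit δ) (hC : IsClubIn C δ) :
    IsClubIn (thin good C) δ := by
  obtain ⟨h1, h2, h3⟩ := (isClubIn_iff hδ).1 hC
  rw [isClubIn_iff hδ]
  refine ⟨thin_subset.trans h1, ?_, fun β hβ h => ⟨h3 β hβ ⟨h.1, h.2.mono fun ν hν _ => hν.1⟩, ?_⟩⟩
  · by_cases hp : CofinalIn {ν | Picked good C ν} δ
    · exact (cofinalIn_pickBases hp).mono fun ν hν _ => ⟨pickBases_subset hν, Or.inl hν⟩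
    -- If the picks are bounded, the tail of `C` above them keeps the thinned set unbounded.
    · obtain ⟨η, hη, hb⟩ := not_cofinalIn.1 hp
      intro ξ hξ
      obtain ⟨x, hx, h4, h5⟩ := h2 (max ξ η) (max_lt hξ hη)
      exact ⟨x, ⟨hx, Or.inr (Or.inr fun ν hν =>
        (hb ν hν (h1 hν.mem)).trans_lt ((le_max_right _ _).trans_lt h4))⟩,
        (le_max_left _ _).trans_lt h4, h5⟩
  · rcases limitPoints_thin_cases h with hc | ⟨x, hx, -, hc⟩
    · exact Or.inr (Or.inl ⟨h.1, cofinalIn_pickBases hc⟩)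
    · exact Or.inr (Or.inr fun ν hν => (hc ν hν).trans hx)

theorem cofinalIn_picked_of_good
    (h : ∀ ξ < γ, ∃ β ∈ C, ∃ ν ∈ C, ξ < β ∧ β < ν ∧ ν < γ ∧ good β ν) :
    CofinalIn {ν | Picked good C ν} γ := by
  by_contra hc
  obtain ⟨ξ, hξ, hb⟩ := not_cofinalIn.1 hc
  obtain ⟨β, hβ, ν, hν, h1, h2, h3, h4⟩ := h ξ hξ
  have hp : Picked good C ν := picked_iff.2 ⟨hν, β, hβ, h2, h4,
    fun ν' h5 h6 => (hb ν' h6 (h5.trans h3)).trans h1.le⟩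
  exact absurd (hb ν hp h3) (not_le.2 (h1.trans h2))

theorem thin_subset_of_good {D : Set Ordinal.{u}} (hCδ : C ⊆ Iio δ)
    (hD : ∀ β < δ, β ∈ limitPoints D → β ∈ D)
    (hp : CofinalIn {ν | Picked good C ν} δ)
    (h : ∀ ν, Picked good C ν → pickBase good C ν ∈ D) : thin good C ⊆ D := by
  have hb : pickBases good C ⊆ D := by rintro _ ⟨ν, hν, rfl⟩; exact h ν hν
  rintro x ⟨hxC, hx | hx | hx⟩
  · exact hb hx
  · exact hD x (hCδ hxC) ⟨hx.1, hx.2.mono fun ν hν _ => hb hν⟩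
  · obtain ⟨ν, hν, h1, -⟩ := hp x (hCδ hxC)
    exact absurd (hx ν hν) h1.not_gt

/-- The intervals between consecutive bases cover `δ`: each `ξ` is decided by the least picked `ν`
whose base is at least `ξ`, and there the attached set is right. -/
theorem guess_eq_of_good {A : Set Ordinal.{u}}
    (hp : CofinalIn {ν | Picked good C ν} δ)
    (h : ∀ ν, Picked good C ν → G (pickBase good C ν) ν = A ∩ Iic (pickBase good C ν)) :
    guess good G C δ = A ∩ Iio δ := by
  ext ξ
  constructor
  · rintro ⟨h1, ν, h2, -, -, h5⟩
    rw [h ν h2] at h5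
    exact ⟨h5.1, h1⟩
  · rintro ⟨hA, hξ⟩
    have hne : {ν | Picked good C ν ∧ ξ ≤ pickBase good C ν}.Nonempty := by
      obtain ⟨_, ⟨ν, hν, rfl⟩, h1, -⟩ := cofinalIn_pickBases hp ξ hξ
      exact ⟨ν, hν, h1.le⟩
    have hm := csInf_mem hne
    refine ⟨hξ, _, hm.1, hm.2, fun ν' h1 h2 => ?_, ?_⟩
    · by_contra! hc
      exact notMem_of_lt_csInf' h1 ⟨h2, hc⟩
    · rw [h _ hm.1]; exact ⟨hA, hm.2⟩

/-- Picks and bases interleave, so a limit of picks below `δ` is a limit of bases and lies in `acc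
(thin good C)`. Hence limits of limits are needed. -/
theorem isLUB_acc_thin (hδ : δ ≠ 0) (hC : IsClubIn C δ)
    (h : CofinalIn (limitPoints {ν | Picked good C ν}) δ) : IsLUB (acc (thin good C)) δ := by
  have hl := (cofinalIn_limitPoints h).isSuccLimit hδ
  have hsub : acc (thin good C) ⊆ Iio δ := fun x hx => hC.1 hx.1.1
  rw [← inter_eq_left.2 hsub, isLUB_iff_cofinalIn]
  refine h.mono fun ν hν hlt => ?_
  have hb := cofinalIn_pickBases hν.2
  have hc := ((isClubIn_iff hl).1 hC).2.2 ν hlt ⟨hν.1, hb.mono fun x hx _ => pickBases_subset hx⟩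
  exact mem_acc.2 ⟨⟨hc, Or.inr (Or.inl ⟨hν.1, hb⟩)⟩, hν.1,
    hb.mono fun x hx _ => ⟨pickBases_subset hx, Or.inl hx⟩⟩

end

/-! ### Catching points of the guessing set -/

section

/-- Every `α ∈ R` has the following property: for every club `B ⊆ C α` of `α` and every function
`i` from `α` to `λ`, some `δ ∈ T` is a limit of limits of points of `B` where `i` has a fixed bound
below `λ`, and `C δ` is an initial segment of `C α` of size less than `λ`. -/
def CatchesIn (lam : Cardinal.{u}) (C : Ordinal.{u} → Set Ordinal.{u}) (T R : Set Ordinal.{u}) :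
    Prop :=
  ∀ α ∈ R, ∀ B ⊆ C α, IsClubIn B α → ∀ i : Ordinal.{u} → Ordinal.{u}, (∀ β < α, i β < lam.ord) →
    ∃ δ ∈ T, δ ≤ α ∧ C δ = C α ∩ Iio δ ∧ Cardinal.mk (C δ) < Cardinal.lift.{u + 1} lam ∧
      ∃ j < lam.ord, δ ∈ limitPoints (limitPoints {β ∈ B | i β < j})

variable {N M : Set Ordinal.{u}} {δ α β : Ordinal.{u}} {c lam : Cardinal.{u}}

theorem limitPoints_mono (h : ∀ ν ∈ N, ν < β → ν ∈ M) (hβ : β ∈ limitPoints N) :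
    β ∈ limitPoints M :=
  ⟨hβ.1, hβ.2.mono h⟩

theorem mk_inter_Iio_lt (hN : OtpLE N c.ord) (hβ : β ∈ N) :
    Cardinal.mk (N ∩ Iio β : Set Ordinal.{u}) < Cardinal.lift.{u + 1} c := by
  have h1 := (Ordinal.typein_lt_type (fun x y : N => x < y) ⟨β, hβ⟩).trans_le hN
  rw [Cardinal.lift_ord, Cardinal.lt_ord, Ordinal.card_typein] at h1
  refine lt_of_le_of_lt ?_ h1
  exact Cardinal.mk_le_of_injective
    (f := fun x : (N ∩ Iio β : Set Ordinal.{u}) => ⟨⟨x.1, x.2.1⟩, x.2.2⟩)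
    (fun x y hxy => by simpa [Subtype.ext_iff] using hxy)

theorem cof_type_of_cofinalIn (hN : N ⊆ Iio δ) (h : CofinalIn N δ) :
    (Ordinal.type (fun x y : N => x < y)).cof = Cardinal.lift.{u + 1} δ.cof := by
  have hc : IsCofinal {x : Iio δ | (x : Ordinal) ∈ N} := by
    intro x
    obtain ⟨ν, hν, h1, h2⟩ := h x x.2
    exact ⟨⟨ν, h2⟩, hν, h1.le⟩
  rw [Ordinal.cof_type, ← cof_Iio_ordinal, ← Order.cof_eq_of_isCofinal hc]
  refine OrderIso.cof_congr ⟨⟨fun x => ⟨⟨x.1, hN x.2⟩, x.2⟩, fun x => ⟨x.1.1, x.2⟩,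
    fun x => rfl, fun x => rfl⟩, Iff.rfl⟩

/-- The order type of `N` has the cofinality of `δ`, so it cannot equal `λ`. -/
theorem mk_lt_of_cof_ne (hδ : Order.IsSuccLimit δ) (hN : IsClubIn N δ) (ho : OtpLE N lam.ord)
    (hne : δ.cof ≠ lam.ord.cof) : Cardinal.mk N < Cardinal.lift.{u + 1} lam := by
  have h : Ordinal.type (fun x y : N => x < y) < Ordinal.lift.{u + 1} lam.ord := by
    refine lt_of_le_of_ne ho fun he => hne ?_
    have := cof_type_of_cofinalIn hN.1 (hN.cofinalIn hδ)
    rw [he, ← Ordinal.lift_cof, Cardinal.lift_inj] at this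
    exact this.symm
  rwa [Cardinal.lift_ord, Cardinal.lt_ord, Ordinal.card_type] at h

theorem cof_lt_of_limitPoints {K : Set Ordinal.{u}} (hK : CofinalIn K δ)
    (ht : OtpLE K δ.cof.ord) (hβδ : β < δ) (hβ : β ∈ limitPoints K) : β.cof < δ.cof := by
  obtain ⟨k, hk, h1, -⟩ := hK β hβδ
  rw [← Cardinal.lift_lt.{_, u + 1}]
  have h2 : CofinalIn (K ∩ Iio β) β := hβ.2.mono fun ν h3 h4 => ⟨h3, h4⟩
  refine (h2.lift_cof_le inter_subset_right).trans_lt (lt_of_le_of_lt ?_ (mk_inter_Iio_lt ht hk))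
  exact Cardinal.mk_le_mk_of_subset (inter_subset_inter_right K (Iio_subset_Iio h1.le))

theorem isSuccLimit_ord (hlam : Cardinal.aleph0 ≤ lam) : Order.IsSuccLimit lam.ord :=
  Cardinal.isSuccLimit_ord hlam

theorem catchesIn_self {C : Ordinal.{u} → Set Ordinal.{u}} {T : Set Ordinal.{u}}
    (hlam : Cardinal.aleph0 ≤ lam)
    (hT : ∀ α ∈ T, Cardinal.aleph0 < α.cof ∧ α.cof ≠ lam.ord.cof ∧ IsClubIn (C α) α ∧
      OtpLE (C α) lam.ord) :
    CatchesIn lam C T T := by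
  intro α hα B hB hBc i hi
  obtain ⟨h1, h2, h3, h4⟩ := hT α hα
  have hl := isSuccLimit_of_aleph0_lt_cof h1
  obtain ⟨j, hj, hN⟩ := (hBc.cofinalIn hl).exists_bounded (isSuccLimit_ord hlam) hl h2
    (i := i) fun ν _ hν => hi ν hν
  refine ⟨α, hα, le_rfl, (inter_eq_left.2 h3.1).symm, mk_lt_of_cof_ne hl h3 h4 h2, j, hj,
    hl.ne_bot, ?_⟩
  exact ((isClubIn_limitPoints h1 hN).cofinalIn hl).mono fun ν hν _ => hν.1

theorem catchesIn_of_reflects {C : Ordinal.{u} → Set Ordinal.{u}} {S R : Set Ordinal.{u}}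
    (hlam : Cardinal.aleph0 ≤ lam)
    (hR : ∀ α ∈ R, Cardinal.aleph0 < α.cof ∧ IsStationaryIn S α ∧ IsClubIn (C α) α ∧
      OtpLE (C α) lam.ord ∧ ∀ β ∈ acc (C α), C β = C α ∩ Iio β) :
    CatchesIn lam C S R := by
  intro α hα B hB hBc i hi
  obtain ⟨h1, hS, h3, h4, hcoh⟩ := hR α hα
  have hl := isSuccLimit_of_aleph0_lt_cof h1
  have hlo := isSuccLimit_ord hlam
  have key : ∀ δ ∈ S, δ < α → ∀ j < lam.ord, δ ∈ limitPoints (limitPoints {β ∈ B | i β < j}) →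
      ∃ δ ∈ S, δ ≤ α ∧ C δ = C α ∩ Iio δ ∧ Cardinal.mk (C δ) < Cardinal.lift.{u + 1} lam ∧
      ∃ j < lam.ord, δ ∈ limitPoints (limitPoints {β ∈ B | i β < j}) := by
    intro δ hδS hδα j hj hδ
    have h5 : δ ∈ limitPoints (C α) :=
      ⟨hδ.1, (cofinalIn_limitPoints hδ.2).mono fun ν hν _ => hB hν.1⟩
    have h6 := ((isClubIn_iff hl).1 h3).2.2 δ hδα h5
    have h7 := hcoh δ (mem_acc.2 ⟨h6, h5⟩)
    exact ⟨δ, hδS, hδα.le, h7, h7 ▸ mk_inter_Iio_lt h4 h6, j, hj, hδ⟩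
  by_cases hne : α.cof = lam.ord.cof
  -- Now `i` may have no uniform bound on a cofinal subset of `B`. But limit points of `K` below `α`
  -- have cofinality below cf(α) = cf(λ), so bounds exist locally: first a bound `jf b` at each `b ∈
  -- M`, then a bound on `jf` cofinally in `δ`.
  · obtain ⟨K, -, hKα, hKc, hKt⟩ := (hBc.cofinalIn hl).exists_subset hl
    set M := (limitPoints B ∩ Iio α) ∩ (limitPoints K ∩ Iio α)
    have hM : IsClubIn M α :=
      (isClubIn_limitPoints h1 (hBc.cofinalIn hl)).inter h1 (isClubIn_limitPoints h1 hKc)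
    have hcof : ∀ b < α, b ∈ limitPoints K → b.cof ≠ lam.ord.cof := fun b hb hbK =>
      hne ▸ (cof_lt_of_limitPoints hKc hKt.le hb hbK).ne
    have hj : ∀ b ∈ M, ∃ j < lam.ord, b ∈ limitPoints {β ∈ B | i β < j} := by
      rintro b ⟨⟨hbB, hb⟩, hbK, -⟩
      obtain ⟨j, hj, h⟩ := hbB.2.exists_bounded hlo (hbB.2.isSuccLimit hbB.1) (hcof b hb hbK)
        (i := i) fun ν _ hν => hi ν (hν.trans hb)
      exact ⟨j, hj, hbB.1, h⟩
    choose! jf hjf hjf' using hj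
    obtain ⟨δ, hδS, ⟨hδM, hδ⟩, -⟩ :=
      hS.exists_mem (isClubIn_limitPoints h1 (hM.cofinalIn hl))
    have hδK : δ ∈ limitPoints K :=
      ⟨hδM.1, cofinalIn_limitPoints (hδM.2.mono fun ν hν _ => hν.2.1)⟩
    obtain ⟨j, hj, h⟩ := hδM.2.exists_bounded hlo (hδM.2.isSuccLimit hδM.1) (hcof δ hδ hδK)
      (i := jf) fun ν hν _ => hjf ν hν
    refine key δ hδS hδ j hj ⟨hδM.1, h.mono ?_⟩
    rintro b ⟨hb, hbj⟩ -
    exact limitPoints_mono (fun ν hν _ => ⟨hν.1, hν.2.trans hbj⟩) (hjf' b hb)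
  · obtain ⟨j, hj, hN⟩ := (hBc.cofinalIn hl).exists_bounded hlo hl hne
      (i := i) fun ν _ hν => hi ν hν
    have hL := isClubIn_limitPoints h1 hN
    obtain ⟨δ, hδS, ⟨hδL, hδ⟩, -⟩ :=
      hS.exists_mem (isClubIn_limitPoints h1 (hL.cofinalIn hl))
    exact key δ hδS hδ j hj (limitPoints_mono (fun ν hν _ => hν.1) hδL)

end

/-! ### Enumerations and coding under `CH` -/

section

variable {lam : Cardinal.{u}}

theorem aleph0_lt_cof_succOrd (hlam : Cardinal.aleph0 < lam) :
    Cardinal.aleph0 < (succOrd lam).cof := by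
  rw [succOrd, (Cardinal.isRegular_succ hlam.le).cof_ord]
  exact hlam.trans (Order.lt_succ lam)

theorem cof_succOrd (hlam : Cardinal.aleph0 ≤ lam) : (succOrd lam).cof = Order.succ lam :=
  (Cardinal.isRegular_succ hlam).cof_ord

/-- Enumerations of the ordinals below `λ⁺` in type `λ`. -/
theorem exists_enumerations (lam : Cardinal.{u}) :
    ∃ e : Ordinal.{u} → Ordinal.{u} → Ordinal.{u},
      ∀ ν < succOrd lam, ∀ γ < ν, ∃ i < lam.ord, e ν i = γ := by
  have h : ∀ ν : Ordinal.{u}, ∃ f : Ordinal.{u} → Ordinal.{u},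
      ν < succOrd lam → ∀ γ < ν, ∃ i < lam.ord, f i = γ := by
    intro ν
    by_cases hν : ν < succOrd lam
    swap
    · exact ⟨id, fun h => absurd h hν⟩
    have hc : Cardinal.mk (Iio ν) ≤ Cardinal.mk (Iio lam.ord) := by
      rw [Cardinal.mk_Iio_ordinal, Cardinal.mk_Iio_ordinal, Cardinal.lift_le, Cardinal.card_ord]
      exact Order.lt_succ_iff.1 (Cardinal.lt_ord.1 hν)
    obtain ⟨g⟩ := hc
    classical
    refine ⟨fun i => if h : ∃ γ, (g γ : Ordinal) = i then h.choose else 0, fun _ γ hγ => ?_⟩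
    refine ⟨g ⟨γ, hγ⟩, (g ⟨γ, hγ⟩).2, ?_⟩
    have hex : ∃ γ', (g γ' : Ordinal) = g ⟨γ, hγ⟩ := ⟨_, rfl⟩
    refine (dif_pos hex).trans ?_
    rw [g.injective (Subtype.ext hex.choose_spec)]
  choose e he using h
  exact ⟨e, he⟩

/-- Restriction of a pair of sets to the ordinals up to `β`. -/
def cut (p : Set Ordinal.{u} × Set Ordinal.{u}) (β : Ordinal.{u}) :
    Set Ordinal.{u} × Set Ordinal.{u} :=
  (p.1 ∩ Iic β, p.2 ∩ Iic β)

theorem mk_Iic_le {β : Ordinal.{u}} (hlam : Cardinal.aleph0 ≤ lam) (hβ : β < succOrd lam) :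
    Cardinal.mk (Iic β) ≤ Cardinal.lift.{u + 1} lam := by
  have hs : Order.succ β < succOrd lam :=
    (Cardinal.isSuccLimit_ord (hlam.trans (Order.le_succ lam))).succ_lt hβ
  rw [← Order.Iio_succ, Cardinal.mk_Iio_ordinal, Cardinal.lift_le]
  exact Order.lt_succ_iff.1 (Cardinal.lt_ord.1 hs)

/-- Under `CH_λ`, the bounded parts of `λ × λ`-sequences of pairs of subsets of `λ⁺` can be
enumerated in type `λ⁺`. -/
theorem exists_codes (hlam : Cardinal.aleph0 ≤ lam) (hCH : CH lam) :
    ∃ X : Ordinal.{u} → Ordinal.{u} → Ordinal.{u} → Set Ordinal.{u} × Set Ordinal.{u},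
      ∀ F : Ordinal.{u} → Ordinal.{u} → Set Ordinal.{u} × Set Ordinal.{u}, ∀ β < succOrd lam,
        ∃ γ < succOrd lam, ∀ j < lam.ord, ∀ k < lam.ord, X γ j k = cut (F j k) β := by
  let L := Iio lam.ord
  let Γ := Σ β : Iio (succOrd lam), L → L → Set (Iic (β : Ordinal.{u})) × Set (Iic (β : Ordinal.{u}))
  set l := Cardinal.lift.{u + 1} lam with hldef
  have hl : Cardinal.aleph0 ≤ l := by simpa [l] using hlam
  have hL : Cardinal.mk L = l := by simp [L, l, Cardinal.mk_Iio_ordinal]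
  have h2l : (2 : Cardinal.{u + 1}) ^ l = Cardinal.mk (Iio (succOrd lam)) := by
    rw [Cardinal.mk_Iio_ordinal, succOrd, Cardinal.card_ord, ← hCH]
    simp [l]
  have hll : l * l = l := Cardinal.mul_eq_self hl
  have hpow : l ≤ 2 ^ l := (Cardinal.cantor l).le
  -- There are λ⁺ choices of `β` and at most (2^λ)^(λ·λ) = 2^λ = λ⁺ matrices for each.
  have hΓ : Cardinal.mk Γ ≤ Cardinal.mk (Iio (succOrd lam)) := by
    rw [← h2l, Cardinal.mk_sigma]
    refine (Cardinal.sum_le_sum _ (fun _ => 2 ^ l) fun β => ?_).trans ?_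
    · have hs : Cardinal.mk (Set (Iic (β : Ordinal.{u}))) ≤ 2 ^ l := by
        rw [Cardinal.mk_set]
        exact Cardinal.power_le_power_left two_ne_zero (mk_Iic_le hlam β.2)
      have hp : Cardinal.mk (Set (Iic (β : Ordinal.{u})) × Set (Iic (β : Ordinal.{u}))) ≤ 2 ^ l := by
        rw [Cardinal.mk_prod, Cardinal.lift_id]
        refine (mul_le_mul' hs hs).trans ?_
        rw [Cardinal.mul_eq_self (hl.trans hpow)]
      rw [← Cardinal.power_def, ← Cardinal.power_def, hL, ← Cardinal.power_mul, hll]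
      refine (Cardinal.power_le_power_right hp).trans ?_
      rw [← Cardinal.power_mul, hll]
    · rw [Cardinal.sum_const', ← h2l, Cardinal.mul_eq_self (hl.trans hpow)]
  obtain ⟨g⟩ := hΓ
  classical
  let dec : Γ → Ordinal.{u} → Ordinal.{u} → Set Ordinal.{u} × Set Ordinal.{u} := fun s j k =>
    if h : j < lam.ord ∧ k < lam.ord then
      (Subtype.val '' (s.2 ⟨j, h.1⟩ ⟨k, h.2⟩).1, Subtype.val '' (s.2 ⟨j, h.1⟩ ⟨k, h.2⟩).2)
    else (∅, ∅)
  refine ⟨fun γ => if h : ∃ s, (g s : Ordinal) = γ then dec h.choose else fun _ _ => (∅, ∅),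
    fun F β hβ => ?_⟩
  let s : Γ := ⟨⟨β, hβ⟩, fun j k => (Subtype.val ⁻¹' (F j k).1, Subtype.val ⁻¹' (F j k).2)⟩
  refine ⟨g s, (g s).2, fun j hj k hk => ?_⟩
  have hex : ∃ s', (g s' : Ordinal) = g s := ⟨s, rfl⟩
  have hs : hex.choose = s := g.injective (Subtype.ext hex.choose_spec)
  simp only [hex, dif_pos, hs]
  simp [dec, hj, hk, s, cut, inter_comm]

end

/-! ### Diagonalization against all candidate sequences -/

section

variable {lam : Cardinal.{u}}

/-- The indices below `ν`, enumerated before stage `j`, of codes that agree with the first `k`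
terms of the sequence `Y` up to `β`. -/
def codeSet (X : Ordinal.{u} → Ordinal.{u} → Ordinal.{u} → Set Ordinal.{u} × Set Ordinal.{u})
    (e : Ordinal.{u} → Ordinal.{u} → Ordinal.{u}) (j : Ordinal.{u})
    (Y : Ordinal.{u} → Set Ordinal.{u} × Set Ordinal.{u}) (k β ν : Ordinal.{u}) :
    Set Ordinal.{u} :=
  {γ | γ < ν ∧ (∃ i < j, e ν i = γ) ∧ ∀ k' < k, X γ j k' = cut (Y k') β}

/-- The prediction at `(β, ν)` of the `k`-th term, based on the earlier terms of `Y`. -/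
noncomputable def prediction
    (X : Ordinal.{u} → Ordinal.{u} → Ordinal.{u} → Set Ordinal.{u} × Set Ordinal.{u})
    (e : Ordinal.{u} → Ordinal.{u} → Ordinal.{u}) (j : Ordinal.{u})
    (Y : Ordinal.{u} → Set Ordinal.{u} × Set Ordinal.{u}) (k β ν : Ordinal.{u}) :
    Set Ordinal.{u} × Set Ordinal.{u} :=
  X (sInf (codeSet X e j Y k β ν)) j k

/-- There is a prediction at `(β, ν)`, and its first component contains `β`. -/
def GoodPair (X : Ordinal.{u} → Ordinal.{u} → Ordinal.{u} → Set Ordinal.{u} × Set Ordinal.{u})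
    (e : Ordinal.{u} → Ordinal.{u} → Ordinal.{u}) (j : Ordinal.{u})
    (Y : Ordinal.{u} → Set Ordinal.{u} × Set Ordinal.{u}) (k β ν : Ordinal.{u}) : Prop :=
  (codeSet X e j Y k β ν).Nonempty ∧ β ∈ (prediction X e j Y k β ν).1

theorem exists_recursive_sequence {P : Type*} (d : P)
    (step : Ordinal.{u} → (Ordinal.{u} → P) → P) :
    ∃ Y : Ordinal.{u} → P, ∀ k, ∃ Y' : Ordinal.{u} → P,
      (∀ k' < k, Y' k' = Y k') ∧ Y k = step k Y' := by
  classical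
  let F : (k : Ordinal.{u}) → ((k' : Ordinal.{u}) → k' < k → P) → P :=
    fun k ih => step k fun k' => if h : k' < k then ih k' h else d
  refine ⟨WellFounded.fix (r := (· < ·)) Ordinal.lt_wf F, fun k =>
    ⟨fun k' => if k' < k then WellFounded.fix (r := (· < ·)) Ordinal.lt_wf F k' else d,
      fun k' hk' => if_pos hk', ?_⟩⟩
  rw [WellFounded.fix_eq]
  simp only [F, dite_eq_ite]

/-- If the square with built-in diamond fails, then so does each sequence obtained from a square
sequence by a greedy selection. -/
theorem exists_counterexample {C : Ordinal.{u} → Set Ordinal.{u}} {T : Set Ordinal.{u}}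
    (hC : ∀ α < succOrd lam, Order.IsSuccLimit α →
      IsClubIn (C α) α ∧ OtpLE (C α) lam.ord ∧ ∀ β ∈ acc (C α), C β = C α ∩ Iio β)
    (hno : ¬ SquareDiamond' lam T) (good : Ordinal.{u} → Ordinal.{u} → Prop)
    (G : Ordinal.{u} → Ordinal.{u} → Set Ordinal.{u}) :
    ∃ p : Set Ordinal.{u} × Set Ordinal.{u}, IsClubIn p.1 (succOrd lam) ∧
      ∀ δ ∈ T, δ < succOrd lam → Order.IsSuccLimit δ → thin good (C δ) ⊆ p.1 →
        guess good G (C δ) δ = p.2 ∩ Iio δ → ¬ IsLUB (acc (thin good (C δ))) δ := by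
  classical
  by_contra! hcon
  -- The value `∅` elsewhere has no accumulation points, so coherence is vacuous there.
  refine hno ⟨fun δ => if δ < succOrd lam ∧ Order.IsSuccLimit δ then thin good (C δ) else ∅,
    fun δ => guess good G (C δ) δ, fun α hα hl => ?_, fun α hα β hβ => ?_, fun D A hD _ => ?_⟩
  · obtain ⟨h1, h2, -⟩ := hC α hα hl
    simp only [hα, hl, and_self, if_true]
    refine ⟨isClubIn_thin hl h1, le_trans ?_ h2⟩
    exact Ordinal.type_le_iff'.2 ⟨⟨⟨fun x => ⟨x.1, x.2.1⟩, fun x y hxy => by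
      simpa [Subtype.ext_iff] using hxy⟩, Iff.rfl⟩⟩
  · dsimp only at hβ
    split_ifs at hβ with hα'
    swap
    · exact absurd hβ.1 (notMem_empty β)
    obtain ⟨h1, -, h3⟩ := hC α hα'.1 hα'.2
    have hβl := (mem_acc.1 hβ).2
    have hβα : β < α := h1.1 hβ.1.1
    have hβC : β ∈ acc (C α) :=
      mem_acc.2 ⟨hβ.1.1, limitPoints_mono (fun ν hν _ => hν.1) hβl⟩
    have hβlim : β < succOrd lam ∧ Order.IsSuccLimit β :=
      ⟨hβα.trans hα, hβl.2.isSuccLimit hβl.1⟩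
    simp only [hα', hβlim, and_self, if_true]
    rw [h3 β hβC]
    exact ⟨thin_inter_Iio hβl, guess_inter_Iio hβl hβα.le⟩
  · obtain ⟨δ, h1, h2, h3, h4, h5, h6⟩ := hcon (D, A) hD
    refine ⟨δ, h2, h3, ?_⟩
    simp only [h2, h3, and_self, if_true]
    exact ⟨h4, h5, h1, h6⟩

/-- A decreasing sequence of length `λ` of families of fewer than `λ` sets of candidates
stabilizes. -/
theorem exists_stable_stage (hlam : Cardinal.aleph0 ≤ lam) {C : Set Ordinal.{u}}
    (hC : Cardinal.mk C < Cardinal.lift.{u + 1} lam) {j : Ordinal.{u}} (hj : j < lam.ord)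
    (e : Ordinal.{u} → Ordinal.{u} → Ordinal.{u})
    (V : Ordinal.{u} → Ordinal.{u} → Ordinal.{u} → Set Ordinal.{u})
    (hV : ∀ k k' β ν, k ≤ k' → V k' β ν ⊆ V k β ν)
    (he : ∀ k β ν, ∀ γ ∈ V k β ν, ∃ i < j, e ν i = γ) :
    ∃ k < lam.ord, ∀ β ∈ C, ∀ ν ∈ C, V k β ν ⊆ V (Order.succ k) β ν := by
  by_contra! hcon
  have h : ∀ k : Iio lam.ord, ∃ p : C × C × Iio j, e p.2.1 p.2.2 ∈ V k p.1 p.2.1 ∧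
      e p.2.1 p.2.2 ∉ V (Order.succ k) p.1 p.2.1 := by
    rintro ⟨k, hk⟩
    obtain ⟨β, hβ, ν, hν, hsub⟩ := hcon k hk
    obtain ⟨γ, h1, h2⟩ := not_subset.1 hsub
    obtain ⟨i, hi, rfl⟩ := he k β ν γ h1
    exact ⟨⟨⟨β, hβ⟩, ⟨ν, hν⟩, ⟨i, hi⟩⟩, h1, h2⟩
  choose f hf1 hf2 using h
  -- Candidate sets only shrink, so a triple lost after stage `k` cannot be lost again; λ losses
  -- would need λ triples.
  have hinj : Function.Injective f := by
    intro k k' hkk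
    by_contra hne
    rcases lt_or_gt_of_ne hne with hlt | hlt
    · refine hf2 k ?_
      rw [hkk]
      exact hV _ _ _ _ (Order.succ_le_of_lt hlt) (hf1 k')
    · refine hf2 k' ?_
      rw [← hkk]
      exact hV _ _ _ _ (Order.succ_le_of_lt hlt) (hf1 k)
  have hle := Cardinal.mk_le_of_injective hinj
  have hinf : Cardinal.aleph0 ≤ Cardinal.lift.{u + 1} lam := by simpa using hlam
  rw [Cardinal.mk_Iio_ordinal, Cardinal.card_ord, Cardinal.mk_prod, Cardinal.mk_prod,
    Cardinal.mk_Iio_ordinal] at hle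
  simp only [Cardinal.lift_id] at hle
  refine hle.not_gt (Cardinal.mul_lt_of_lt hinf hC (Cardinal.mul_lt_of_lt hinf hC ?_))
  rw [Cardinal.lift_lt]
  exact Cardinal.lt_ord.1 hj

theorem isClubIn_closure_points (hlam : Cardinal.aleph0 < lam) {g : Ordinal.{u} → Ordinal.{u}}
    (hg : ∀ β < succOrd lam, g β < succOrd lam) :
    IsClubIn {ν | ν < succOrd lam ∧ ∀ β < ν, g β < ν} (succOrd lam) := by
  have hcof := aleph0_lt_cof_succOrd hlam
  have hl := isSuccLimit_of_aleph0_lt_cof hcof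
  have hb : ∀ ξ < succOrd lam, ∃ ζ < succOrd lam, ξ < ζ ∧ ∀ β ≤ ξ, g β < ζ := by
    intro ξ hξ
    obtain ⟨ζ, h1, h2⟩ := exists_bound_of_mk_lt (δ := succOrd lam) (N := g '' Iic ξ)
      (by rintro _ ⟨β, hβ, rfl⟩; exact hg β (lt_of_le_of_lt hβ hξ))
      (Cardinal.mk_image_le.trans_lt ((mk_Iic_le hlam.le hξ).trans_lt (by
        rw [cof_succOrd hlam.le, Cardinal.lift_lt]; exact Order.lt_succ lam)))
    exact ⟨max ζ (Order.succ ξ), max_lt h1 (hl.succ_lt hξ),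
      (Order.lt_succ ξ).trans_le (le_max_right _ _),
      fun β hβ => (h2 _ ⟨β, hβ, rfl⟩).trans_le (le_max_left _ _)⟩
  choose! h hh1 hh2 hh3 using hb
  rw [isClubIn_iff hl]
  refine ⟨fun ν hν => hν.1, fun ξ hξ => ?_, fun β hβ hβl => ⟨hβ, fun ζ hζ => ?_⟩⟩
  · obtain ⟨η, h1, h2, h3⟩ := exists_gt_of_step hcof h (fun ξ hξ => ⟨hh2 ξ hξ, hh1 ξ hξ⟩) hξ
    refine ⟨η, ⟨h2, fun β hβ => ?_⟩, h1, h2⟩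
    obtain ⟨ζ, h4, h5, h6⟩ := h3 β hβ
    exact (hh3 ζ (h5.trans h2) β h4.le).trans h6
  · obtain ⟨ν, hν, h1, h2⟩ := hβl.2 ζ hζ
    exact (hν.2 ζ h1).trans h2

theorem squareDiamond'_of_catchesIn (hlam : Cardinal.aleph0 < lam) (hCH : CH lam)
    {C : Ordinal.{u} → Set Ordinal.{u}} {T R : Set Ordinal.{u}}
    (hC : ∀ α < succOrd lam, Order.IsSuccLimit α →
      IsClubIn (C α) α ∧ OtpLE (C α) lam.ord ∧ ∀ β ∈ acc (C α), C β = C α ∩ Iio β)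
    (hR : IsStationaryIn R (succOrd lam)) (hRcof : ∀ α ∈ R, Cardinal.aleph0 < α.cof)
    (hcatch : CatchesIn lam C T R) : SquareDiamond' lam T := by
  by_contra hno
  have hcof := aleph0_lt_cof_succOrd hlam
  have hl := isSuccLimit_of_aleph0_lt_cof hcof
  have hlo := isSuccLimit_ord hlam.le
  obtain ⟨X, hX⟩ := exists_codes hlam.le hCH
  obtain ⟨e, he⟩ := exists_enumerations lam
  have hbad := fun j k (Y : Ordinal.{u} → Set Ordinal.{u} × Set Ordinal.{u}) =>
    exists_counterexample hC hno (GoodPair X e j Y k) fun β ν => (prediction X e j Y k β ν).2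
  choose bad hbadclub hbad using hbad
  choose Y hY using fun j => exists_recursive_sequence (∅, ∅) (bad j)
  have hYclub : ∀ j k, IsClubIn (Y j k).1 (succOrd lam) := by
    intro j k
    obtain ⟨Y', -, h⟩ := hY j k
    rw [h]
    exact hbadclub j k Y'
  have hYbad : ∀ j k, ∀ δ ∈ T, δ < succOrd lam → Order.IsSuccLimit δ →
      thin (GoodPair X e j (Y j) k) (C δ) ⊆ (Y j k).1 →
      guess (GoodPair X e j (Y j) k) (fun β ν => (prediction X e j (Y j) k β ν).2) (C δ) δ =
        (Y j k).2 ∩ Iio δ →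
      ¬ IsLUB (acc (thin (GoodPair X e j (Y j) k) (C δ))) δ := by
    intro j k
    obtain ⟨Y', h1, h2⟩ := hY j k
    -- Codes at step `k` are compared only with terms before `k`, where `Y'` and `Y j` agree.
    have hcode : codeSet X e j Y' k = codeSet X e j (Y j) k := by
      funext β ν
      ext γ
      refine and_congr_right fun _ => and_congr_right fun _ => forall₂_congr fun k' hk' => ?_
      rw [h1 k' hk']
    have hpred : prediction X e j Y' k = prediction X e j (Y j) k := by
      funext β ν
      rw [prediction, hcode, prediction]
    have hgood : GoodPair X e j Y' k = GoodPair X e j (Y j) k := by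
      funext β ν
      rw [GoodPair, hcode, hpred, GoodPair]
    have := hbad j k Y'
    rw [hgood, hpred, ← h2] at this
    exact this
  -- One code `g β` serves the whole matrix `Y` up to `β`, hence every `j` and `k` at once; these
  -- are not known until `δ` is caught.
  choose! g hg hgX using fun β (hβ : β < succOrd lam) => hX Y β hβ
  have h0 : (0 : Ordinal.{u}) < lam.ord := hlo.bot_lt
  have : Nonempty (Iio lam.ord × Iio lam.ord) := ⟨(⟨0, h0⟩, ⟨0, h0⟩)⟩
  have hDall : IsClubIn (⋂ p : Iio lam.ord × Iio lam.ord, (Y p.1 p.2).1) (succOrd lam) := by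
    refine IsClubIn.iInter hcof ?_ fun p => hYclub _ _
    rw [Cardinal.mk_prod, Cardinal.mk_Iio_ordinal, Cardinal.card_ord, Cardinal.lift_id,
      Cardinal.mul_eq_self (by simpa using hlam.le), cof_succOrd hlam.le, Cardinal.lift_lt]
    exact Order.lt_succ lam
  have hclub := hDall.inter hcof (isClubIn_closure_points hlam hg)
  set D := (⋂ p : Iio lam.ord × Iio lam.ord, (Y p.1 p.2).1) ∩
    {ν | ν < succOrd lam ∧ ∀ β < ν, g β < ν} with hD
  obtain ⟨α, hαR, ⟨hαD, -⟩, hα⟩ := hR.exists_mem (isClubIn_limitPoints hcof (hclub.cofinalIn hl))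
  have hαcof := hRcof α hαR
  have hαl := isSuccLimit_of_aleph0_lt_cof hαcof
  have hDα : IsClubIn (D ∩ Iio α) α := by
    rw [isClubIn_iff hαl]
    refine ⟨inter_subset_right, hαD.2.mono fun ν h1 h2 => ⟨h1, h2⟩, fun β hβ h => ⟨?_, hβ⟩⟩
    exact ((isClubIn_iff hl).1 hclub).2.2 β (hβ.trans hα)
      (limitPoints_mono (fun ν hν _ => hν.1) h)
  set B := C α ∩ (D ∩ Iio α) with hB
  have hBclub : IsClubIn B α := (hC α hα hαl).1.inter hαcof hDα
  -- `i β` is a stage listing `g β` at the next point of `B`; the default 0 is used only when there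
  -- is no such stage.
  have hi : ∀ β, ∃ i < lam.ord, (∃ i' < lam.ord, e (sInf (B ∩ Ioi β)) i' = g β) →
      e (sInf (B ∩ Ioi β)) i = g β := by
    intro β
    by_cases h : ∃ i' < lam.ord, e (sInf (B ∩ Ioi β)) i' = g β
    · obtain ⟨i, h1, h2⟩ := h
      exact ⟨i, h1, fun _ => h2⟩
    · exact ⟨0, h0, fun h' => absurd h' h⟩
  choose i hi hie using hi
  obtain ⟨δ, hδT, hδα, hCδ, hcard, j, hj, hδ⟩ :=
    hcatch α hαR B inter_subset_left hBclub i fun β _ => hi β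
  have hδN : δ ∈ limitPoints {β ∈ B | i β < j} := ⟨hδ.1, cofinalIn_limitPoints hδ.2⟩
  have hδl := hδN.2.isSuccLimit hδN.1
  have hδlt := hδα.trans_lt hα
  obtain ⟨k, hk, hstable⟩ := exists_stable_stage hlam.le hcard hj e
    (fun k => codeSet X e j (Y j) k)
    (fun k k' β ν hkk γ hγ => ⟨hγ.1, hγ.2.1, fun l hl => hγ.2.2 l (hl.trans_le hkk)⟩)
    (fun k β ν γ hγ => hγ.2.1)
  -- All pairs from `C δ` must be covered, as the greedy selection may use pairs outside `B`.
  have hpred : ∀ β ∈ C δ, ∀ ν ∈ C δ, (codeSet X e j (Y j) k β ν).Nonempty →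
      prediction X e j (Y j) k β ν = cut (Y j k) β := fun β hβ ν hν hne =>
    (hstable β hβ ν hν (csInf_mem hne)).2.2 k (Order.lt_succ k)
  have hpairs : ∀ γ ≤ δ, γ ∈ limitPoints {β ∈ B | i β < j} →
      CofinalIn {ν | Picked (GoodPair X e j (Y j) k) (C δ) ν} γ := by
    intro γ hγδ hγ
    refine cofinalIn_picked_of_good fun ξ hξ => ?_
    obtain ⟨β, ⟨hβB, hβj⟩, h1, h2⟩ := hγ.2 ξ hξ
    obtain ⟨b, ⟨hbB, -⟩, h3, h4⟩ := hγ.2 β h2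
    have hne : (B ∩ Ioi β).Nonempty := ⟨b, hbB, h3⟩
    obtain ⟨hνB, hβν⟩ := csInf_mem hne
    have hνγ : sInf (B ∩ Ioi β) < γ := (csInf_le' (show b ∈ B ∩ Ioi β from ⟨hbB, h3⟩)).trans_lt h4
    have hieβ := hie β
    generalize sInf (B ∩ Ioi β) = ν at hνB hβν hνγ hieβ
    have hβδ : β ∈ C δ := by rw [hCδ]; exact ⟨hβB.1, h2.trans_le hγδ⟩
    have hνδ : ν ∈ C δ := by rw [hCδ]; exact ⟨hνB.1, hνγ.trans_le hγδ⟩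
    have hνlt : ν < succOrd lam := hνB.2.1.2.1
    have hgν : g β < ν := hνB.2.1.2.2 β hβν
    have hcode : (codeSet X e j (Y j) k β ν).Nonempty :=
      ⟨g β, hgν, ⟨i β, hβj, hieβ (he ν hνlt _ hgν)⟩,
        fun k' hk' => hgX β (hβν.trans hνlt) j hj k' (hk'.trans hk)⟩
    refine ⟨β, hβδ, ν, hνδ, h1, hβν, hνγ, hcode, ?_⟩
    rw [hpred β hβδ ν hνδ hcode]
    -- `cut` retains `β` itself, so the prediction can certify that the base lies in the club.
    exact ⟨mem_iInter.1 hβB.2.1.1 (⟨j, hj⟩, ⟨k, hk⟩), self_mem_Iic⟩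
  have hpicked := hpairs δ le_rfl hδN
  have hbase : ∀ ν, Picked (GoodPair X e j (Y j) k) (C δ) ν →
      prediction X e j (Y j) k (pickBase (GoodPair X e j (Y j) k) (C δ) ν) ν =
        cut (Y j k) (pickBase (GoodPair X e j (Y j) k) (C δ) ν) := fun ν hν =>
    hpred _ hν.pickBase_mem.1 ν hν.mem hν.pickBase_mem.2.2.1.1
  obtain ⟨hCclub, -, -⟩ := hC δ hδlt hδl
  refine hYbad j k δ hδT hδlt hδl ?_ ?_ ?_
  · refine thin_subset_of_good hCclub.1
      (fun β hβ => ((isClubIn_iff hl).1 (hYclub j k)).2.2 β (hβ.trans hδlt)) hpicked fun ν hν => ?_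
    have := hν.pickBase_mem.2.2.1.2
    rw [hbase ν hν] at this
    exact this.1
  · exact guess_eq_of_good hpicked fun ν hν => by rw [hbase ν hν]; rfl
  · exact isLUB_acc_thin hδN.1 hCclub
      (hδ.2.mono fun γ hγ hγδ => ⟨hγ.1, hpairs γ hγδ.le hγ⟩)

end

end OstSquare

theorem theorem2p2 (lam : Cardinal.{u}) (hlam : Cardinal.aleph0 < lam)
    (hsquare : OstSquare.Square lam) (hCH : OstSquare.CH lam) :
    (∀ T : Set Ordinal.{u},
      T ⊆ OstSquare.EGt (OstSquare.succOrd lam) Cardinal.aleph0 ∩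
        OstSquare.ENe (OstSquare.succOrd lam) lam.ord.cof →
      OstSquare.IsStationaryIn T (OstSquare.succOrd lam) →
      OstSquare.SquareDiamond' lam T) ∧
    (∀ S : Set Ordinal.{u},
      S ⊆ Set.Iio (OstSquare.succOrd lam) →
      OstSquare.ReflectsStationarilyOften S (OstSquare.succOrd lam) →
      OstSquare.SquareDiamond' lam S) := by
  obtain ⟨C, hC⟩ := hsquare
  refine ⟨fun T hT hstat => ?_, fun S _ hS => ?_⟩
  · refine OstSquare.squareDiamond'_of_catchesIn hlam hCH hC hstat (fun α hα => (hT hα).1.2)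
      (OstSquare.catchesIn_self hlam.le fun α hα => ?_)
    obtain ⟨⟨h1, h2⟩, -, h3⟩ := hT hα
    obtain ⟨h4, h5, -⟩ := hC α h1 (OstSquare.isSuccLimit_of_aleph0_lt_cof h2)
    exact ⟨h2, h3, h4, h5⟩
  · refine OstSquare.squareDiamond'_of_catchesIn hlam hCH hC hS (fun α hα => hα.1.2)
      (OstSquare.catchesIn_of_reflects hlam.le ?_)
    rintro α ⟨⟨h1, h2⟩, h3⟩
    exact ⟨h2, h3, hC α h1 (OstSquare.isSuccLimit_of_aleph0_lt_cof h2)⟩
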